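/- Consider a matching market with regional constraints: finite sets $D$ of doctors, $H$ of hospitals and $R$ of regions, where the hospitals are partitioned into regions, $H=\bigsqcup_{r\in R}H_r$, and $r(h)$ denotes the region of $h$; each hospital $h$ has a capacity $q_h\in\mathbb{Z}_{>0}$ and each region $r$ a regional cap $q_r\in\mathbb{Z}_{\ge 0}$. Each doctor $d$ has a strict (total) preference $\succ_d$ over $H\cup\{\emptyset\}$, where $\emptyset$ means being unmatched. Each hospital $h$ has a strict (total) preference $\succ_h$ over sets of doctors which is responsive with capacity $q_h$: for $|D'|\le q_h$, $d\notin D'$, $d'\in D'$ one has $(D'\cup\{d\})\setminus\{d'\}\succeq_h D'$ iff $\{d\}\succeq_h\{d'\}$, and $D'\succeq_h D'\setminus\{d'\}$ iff $\{d'\}\succeq_h\emptyset$; and $\emptyset\succ_h D'$ whenever $|D'|>q_h$. For single doctors write $d\succ_h d'$ for $\{d\}\succ_h\{d'\}$ and $d\succ_h\emptyset$ for $\{d\}\succ_h\emptyset$ ($d$ is acceptable to $h$); $h$ is acceptable to $d$ if $h\succ_d\emptyset$. A matching $\mu$ assigns to each doctor $d$ some $\mu_d\in H\cup\{\emptyset\}$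 and to each hospital the set $\mu_h=\{d:\mu_d=h\}$. It is feasible if $|\mu_h|\le q_h$ for all $h$ and $|\bigcup_{h\in H_r}\mu_h|\le q_r$ for all $r$. A feasible $\mu$ is constrained efficient if there is no feasible $\mu'$ with $\mu'_i\succeq_i\mu_i$ for all $i\in D\cup H$ and $\mu'_i\succ_i\mu_i$ for some $i\in D\cup H$. It is individually rational if no agent is matched with an unacceptable one. A pair $(d,h)$ is blocking if $h\succ_d\mu_d$ and either $|\mu_h|<q_h$ and $d\succ_h\emptyset$, or $d\succ_h d'$ for some $d'\in\mu_h$. The matching $\mu$ is weakly stable if it is feasible, individually rational, and for every blocking pair $(d,h)$ one has $\sum_{h'\in H_{r(h)}}|\mu_{h'}|=q_{r(h)}$ and $d'\succ_h d$ for all $d'\in\mu_h$. An allocation of the regional caps is a family $(\tilde q_h)_{h\in H}$ of nonnegative integers with $\tilde q_h\le q_h$ for every $h\in H$ and $\sum_{h\in H_r}\tilde q_h\le q_r$ for every $r\in R$. The DA algorithm under this allocation is the doctor-proposing deferred acceptance algorithm in which each hospital $h$ uses $\tilde q_h$ as its capacity: at each step every doctor not currently kept applies to her most preferred acceptable hospital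 that has not yet rejected her (if any); each hospital, among the doctors it has kept and its new applicants, rejects all unacceptable doctors and the lowest-ranking ones in excess of $\tilde q_h$, and temporarily keeps the rest; the algorithm stops when no application occurs, and each hospital is then matched with the doctors it keeps. Then, for every such market and every preference profile, there exists an allocation $(\tilde q_h)_{h\in H}$ of the regional caps under which the DA algorithm terminates and produces a matching that is constrained efficient and weakly stable. -/

import Mathlib

open Classical in
/-- A matching market with regional constraints: doctors `D`, hospitals `H`, regions `R`.
`none : Option H` is the state of being unmatched. -/
structure RegionalMarket (D H R : Type*) where
  /-- `docPref d a b`: doctor `d` strictly prefers `a` to `b`. -/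
  docPref : D → Option H → Option H → Prop
  /-- `hospPref h A B`: hospital `h` strictly prefers the set `A` of doctors to the set `B`. -/
  hospPref : H → Finset D → Finset D → Prop
  /-- physical capacities -/
  capacity : H → ℕ
  /-- the region in which a hospital lies -/
  region : H → R
  /-- regional caps -/
  cap : R → ℕ
  docPref_strict : ∀ d, IsStrictTotalOrder (Option H) (docPref d)
  hospPref_strict : ∀ h, IsStrictTotalOrder (Finset D) (hospPref h)
  capacity_pos : ∀ h, 0 < capacity h
  /-- responsiveness, first part: exchanging one doctor -/
  responsive_swap : ∀ (h : H) (A : Finset D) (d d' : D),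
    A.card ≤ capacity h → d ∉ A → d' ∈ A →
    ((hospPref h ((insert d A).erase d') A ∨ (insert d A).erase d' = A) ↔
      (hospPref h {d} {d'} ∨ d = d'))
  /-- responsiveness, second part: dropping one doctor -/
  responsive_drop : ∀ (h : H) (A : Finset D) (d' : D),
    A.card ≤ capacity h → d' ∈ A →
    ((hospPref h A (A.erase d') ∨ A = A.erase d') ↔
      (hospPref h {d'} ∅ ∨ ({d'} : Finset D) = ∅))
  /-- responsiveness, third part: a set exceeding the capacity is worse than no doctor -/
  responsive_excess : ∀ (h : H) (A : Finset D), capacity h < A.card → hospPref h ∅ A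

/-- A matching, seen from both sides. -/
structure RegionalMatching (D H : Type*) where
  ofDoctor : D → Option H
  ofHospital : H → Finset D
  consistent : ∀ d h, ofDoctor d = some h ↔ d ∈ ofHospital h

namespace RegionalMarket

variable {D H R : Type*} (M : RegionalMarket D H R)

/-- Weak preference of a doctor. -/
def DocWeak (d : D) (a b : Option H) : Prop := M.docPref d a b ∨ a = b

/-- Weak preference of a hospital. -/
def HospWeak (h : H) (A B : Finset D) : Prop := M.hospPref h A B ∨ A = B

/-- Strict preference of hospital `h` over single doctors. -/
def Ranks (h : H) (d d' : D) : Prop := M.hospPref h {d} {d'}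

/-- Doctor `d` is acceptable to hospital `h`. -/
def AcceptableDoctor (h : H) (d : D) : Prop := M.hospPref h {d} ∅

/-- Hospital `h` is acceptable to doctor `d`. -/
def AcceptableHospital (d : D) (h : H) : Prop := M.docPref d (some h) none

open Classical in
/-- The hospitals of region `r`. -/
noncomputable def hospitals [Fintype H] (r : R) : Finset H :=
  Finset.univ.filter fun h => M.region h = r

open Classical in
/-- The doctors matched in region `r`. -/
noncomputable def regionDoctors [Fintype H] (μ : RegionalMatching D H) (r : R) : Finset D :=
  (M.hospitals r).biUnion μ.ofHospital

/-- Feasibility: regional caps and physical capacities are respected. -/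
def Feasible [Fintype H] (μ : RegionalMatching D H) : Prop :=
  (∀ r, (M.regionDoctors μ r).card ≤ M.cap r) ∧ ∀ h, (μ.ofHospital h).card ≤ M.capacity h

/-- `ν` makes every doctor and hospital weakly better off than `μ`, and one of them strictly. -/
def ParetoDominates (ν μ : RegionalMatching D H) : Prop :=
  (∀ d, M.DocWeak d (ν.ofDoctor d) (μ.ofDoctor d)) ∧
  (∀ h, M.HospWeak h (ν.ofHospital h) (μ.ofHospital h)) ∧
  ((∃ d, M.docPref d (ν.ofDoctor d) (μ.ofDoctor d)) ∨
    ∃ h, M.hospPref h (ν.ofHospital h) (μ.ofHospital h))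

/-- Constrained efficiency. -/
def ConstrainedEfficient [Fintype H] (μ : RegionalMatching D H) : Prop :=
  M.Feasible μ ∧ ¬ ∃ ν : RegionalMatching D H, M.Feasible ν ∧ M.ParetoDominates ν μ

/-- Individual rationality: nobody is matched with an unacceptable partner. -/
def IndividuallyRational (μ : RegionalMatching D H) : Prop :=
  ∀ d h, μ.ofDoctor d = some h → M.AcceptableHospital d h ∧ M.AcceptableDoctor h d

/-- Blocking pairs, with respect to the physical capacities. -/
def BlockingPair (μ : RegionalMatching D H) (d : D) (h : H) : Prop :=
  M.docPref d (some h) (μ.ofDoctor d) ∧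
  (((μ.ofHospital h).card < M.capacity h ∧ M.AcceptableDoctor h d) ∨
    ∃ d' ∈ μ.ofHospital h, M.Ranks h d d')

/-- Weak stability. -/
def WeaklyStable [Fintype H] (μ : RegionalMatching D H) : Prop :=
  M.Feasible μ ∧ M.IndividuallyRational μ ∧
  ∀ d h, M.BlockingPair μ d h →
    (∑ h' ∈ M.hospitals (M.region h), (μ.ofHospital h').card = M.cap (M.region h)) ∧
    ∀ d' ∈ μ.ofHospital h, M.Ranks h d' d

/-- An allocation of the regional caps among the hospitals: the allocated capacities respect
every regional cap and every physical capacity.  A hospital may be allocated no seat. -/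
def IsAllocation [Fintype H] (t : H → ℕ) : Prop :=
  (∀ r, ∑ h ∈ M.hospitals r, t h ≤ M.cap r) ∧ ∀ h, t h ≤ M.capacity h

/-- A state of the deferred acceptance algorithm: the doctors temporarily kept by each hospital,
and the hospitals that have rejected each doctor so far. -/
structure DAState (D H : Type*) where
  kept : H → Finset D
  rejectedBy : D → Set H

/-- At the start nobody is kept and nobody has been rejected. -/
def daInit : DAState D H := ⟨fun _ => ∅, fun _ => ∅⟩

/-- In state `s`, doctor `d` is not kept by any hospital and applies to `h`, her most preferred
hospital among the acceptable ones that have not rejected her. -/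
def AppliesTo (s : DAState D H) (d : D) (h : H) : Prop :=
  (∀ h', d ∉ s.kept h') ∧ M.AcceptableHospital d h ∧ h ∉ s.rejectedBy d ∧
  ∀ h', h' ∉ s.rejectedBy d → M.DocWeak d (some h) (some h')

open Classical in
/-- Hospital `h` with `n` seats, facing the pool `A`, rejects all unacceptable doctors and the
lowest-ranking doctors in excess of `n`: these are the doctors whom it keeps. -/
noncomputable def keep (h : H) (n : ℕ) (A : Finset D) : Finset D :=
  A.filter fun d => M.AcceptableDoctor h d ∧ (A.filter fun d' => M.Ranks h d' d).card < n

open Classical in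
/-- The pool of hospital `h`: the doctors it has kept and the new applicants. -/
noncomputable def pool [Fintype D] (s : DAState D H) (h : H) : Finset D :=
  Finset.univ.filter fun d => d ∈ s.kept h ∨ M.AppliesTo s d h

/-- One step of the (doctor-proposing) deferred acceptance algorithm with capacities `t`. -/
noncomputable def daStep [Fintype D] (t : H → ℕ) (s : DAState D H) : DAState D H where
  kept h := M.keep h (t h) (M.pool s h)
  rejectedBy d := {h | h ∈ s.rejectedBy d ∨ d ∈ M.pool s h ∧ d ∉ M.keep h (t h) (M.pool s h)}

/-- The state of the algorithm after `n` steps. -/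
noncomputable def daState [Fintype D] (t : H → ℕ) (n : ℕ) : DAState D H :=
  (M.daStep t)^[n] daInit

/-- The deferred acceptance algorithm with capacities `t` produces `μ`: after finitely many steps
it reaches, for the first time, a state in which no application occurs, and then every hospital
is matched with the doctors that it keeps. -/
def DAProduces [Fintype D] (t : H → ℕ) (μ : RegionalMatching D H) : Prop :=
  ∃ n, (∀ d h, ¬ M.AppliesTo (M.daState t n) d h) ∧
    (∀ m < n, ∃ d h, M.AppliesTo (M.daState t m) d h) ∧
    ∀ h, μ.ofHospital h = (M.daState t n).kept h

end RegionalMarket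

/-!
The allocation is chosen to be good for the doctors: among all allocations of the regional caps,
take one for which the set of pairs `(d, h)` such that `h` rejects `d` in the course of deferred
acceptance is minimal under inclusion (`exists_minimal_allocation`).

*Weak stability.* In a blocking pair `(d, h)` of the outcome `μ`, the hospital `h` has rejected the
acceptable doctor `d`; hence it has filled its allocated seats with doctors better than `d`, and
`|μ_h|` is smaller than the physical capacity. If the region of `h` were not full in `μ`, then
`|μ_{h'}|` seats for every hospital `h'`, and one more for `h`, would be an allocation too. Since
these capacities accommodate all of `μ`, they cause no further rejections
(`rejectedBy_subset_of_card_kept_le`), so by minimality they cause the same ones. The rejections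
determine the outcome, which is therefore `μ` again; but then `h` has a free seat and nevertheless
rejects the acceptable doctor `d`, which is impossible (`sum_card_eq_cap_of_minimal`).

*Constrained efficiency* follows from weak stability by responsiveness
(`WeaklyStable.constrainedEfficient`).
-/

namespace RegionalMarket

/-! ### Preferences -/

section Preferences

variable {D H R : Type*} (M : RegionalMarket D H R)

lemma docPref_trans {d : D} {a b c : Option H} (hab : M.docPref d a b) (hbc : M.docPref d b c) :
    M.docPref d a c :=
  (M.docPref_strict d).trans _ _ _ hab hbc

lemma docPref_irrefl (d : D) (a : Option H) : ¬ M.docPref d a a :=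
  (M.docPref_strict d).irrefl a

lemma docPref_total (d : D) (a b : Option H) : M.docPref d a b ∨ a = b ∨ M.docPref d b a := by
  have := M.docPref_strict d
  exact trichotomous_of (M.docPref d) a b

lemma hospPref_trans {h : H} {A B C : Finset D} (hAB : M.hospPref h A B)
    (hBC : M.hospPref h B C) : M.hospPref h A C :=
  (M.hospPref_strict h).trans _ _ _ hAB hBC

lemma hospPref_irrefl (h : H) (A : Finset D) : ¬ M.hospPref h A A :=
  (M.hospPref_strict h).irrefl A

lemma hospPref_total (h : H) (A B : Finset D) :
    M.hospPref h A B ∨ A = B ∨ M.hospPref h B A := by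
  have := M.hospPref_strict h
  exact trichotomous_of (M.hospPref h) A B

lemma ranks_trans {h : H} {a b c : D} (hab : M.Ranks h a b) (hbc : M.Ranks h b c) :
    M.Ranks h a c :=
  M.hospPref_trans hab hbc

lemma ranks_irrefl (h : H) (a : D) : ¬ M.Ranks h a a :=
  M.hospPref_irrefl h _

lemma ranks_total (h : H) (a b : D) : M.Ranks h a b ∨ a = b ∨ M.Ranks h b a := by
  simpa [Ranks] using M.hospPref_total h {a} {b}

lemma ranks_of_acceptable_of_not {h : H} {a b : D} (ha : M.AcceptableDoctor h a)
    (hb : ¬ M.AcceptableDoctor h b) : M.Ranks h a b := by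
  rcases M.ranks_total h a b with hab | rfl | hba
  · exact hab
  · exact absurd ha hb
  · exact absurd (M.hospPref_trans hba ha) hb

open Classical in
lemma hospPref_erase_of_not_acceptable {h : H} {A : Finset D} {d : D}
    (hA : A.card ≤ M.capacity h) (hd : d ∈ A) (hacc : ¬ M.AcceptableDoctor h d) :
    M.hospPref h (A.erase d) A := by
  have hne : A ≠ A.erase d := fun e => by
    rw [e] at hd
    simp at hd
  have hdrop := M.responsive_drop h A d hA hd
  have hnot : ¬ (M.hospPref h A (A.erase d) ∨ A = A.erase d) := fun hw =>
    (hdrop.1 hw).elim hacc (by simp)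
  rcases M.hospPref_total h A (A.erase d) with h1 | h1 | h1
  · exact absurd (Or.inl h1) hnot
  · exact absurd h1 hne
  · exact h1

open Classical in
lemma hospPref_insert_of_acceptable {h : H} {A : Finset D} {d : D}
    (hA : A.card < M.capacity h) (hd : d ∉ A) (hacc : M.AcceptableDoctor h d) :
    M.hospPref h (insert d A) A := by
  have hdrop := M.responsive_drop h (insert d A) d
    (by rw [Finset.card_insert_of_notMem hd]; omega) (Finset.mem_insert_self d A)
  rw [Finset.erase_insert hd] at hdrop
  rcases hdrop.2 (Or.inl hacc) with h1 | h1
  · exact h1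
  · exact absurd (h1 ▸ Finset.mem_insert_self d A) hd

open Classical in
lemma hospPref_swap_of_ranks {h : H} {A : Finset D} {d d' : D}
    (hA : A.card ≤ M.capacity h) (hd : d ∉ A) (hd' : d' ∈ A) (hr : M.Ranks h d d') :
    M.hospPref h ((insert d A).erase d') A := by
  rcases (M.responsive_swap h A d d' hA hd hd').2 (Or.inl hr) with h1 | h1
  · exact h1
  · have : d' ∈ (insert d A).erase d' := by rw [h1]; exact hd'
    simp at this

open Classical in
lemma sdiff_swap_eq_erase {α : Type*} {A B : Finset α} {a b : α} (ha : a ∈ A \ B)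
    (hb : b ∈ B \ A) : A \ (insert a B).erase b = (A \ B).erase a ∧
      (insert a B).erase b \ A = (B \ A).erase b := by
  simp only [Finset.mem_sdiff] at ha hb
  constructor <;> ext x <;> by_cases h1 : x = a <;> by_cases h2 : x = b <;> simp_all

open Classical in
/-- Comparison of sets by responsiveness. If `A` consists of acceptable doctors and every acceptable
member of `B \ A` is ranked below all of `A`, then `B` cannot be better than `A` unless it is larger
and `B \ A` contains an acceptable doctor: otherwise dropping, exchanging and adding single doctors
leads from `B` to `A` by improvements. -/
lemma hospWeak_of_ranks_sdiff {h : H} {A B : Finset D}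
    (hA : A.card ≤ M.capacity h) (hB : B.card ≤ M.capacity h)
    (hacc : ∀ a ∈ A, M.AcceptableDoctor h a)
    (hrank : ∀ b ∈ B \ A, M.AcceptableDoctor h b → ∀ a ∈ A, M.Ranks h a b)
    (hsize : B.card ≤ A.card ∨ ∀ b ∈ B \ A, ¬ M.AcceptableDoctor h b) :
    M.HospWeak h A B := by
  -- Each elementary improvement reduces the symmetric difference.
  induction hn : (A \ B).card + (B \ A).card using Nat.strong_induction_on generalizing B with
  | _ n ih =>
  have step : ∀ B' : Finset D, M.hospPref h B' B → B'.card ≤ M.capacity h → B' \ A ⊆ B \ A →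
      (B'.card ≤ A.card ∨ ∀ b ∈ B' \ A, ¬ M.AcceptableDoctor h b) →
      (A \ B').card + (B' \ A).card < n → M.HospWeak h A B := by
    intro B' hpref hcard hsub hs hlt
    rcases ih _ hlt hcard (fun b hb => hrank b (hsub hb)) hs rfl with h1 | rfl
    · exact Or.inl (M.hospPref_trans h1 hpref)
    · exact Or.inl hpref
  by_cases hun : ∃ b ∈ B \ A, ¬ M.AcceptableDoctor h b
  · obtain ⟨b, hb, hbacc⟩ := hun
    obtain ⟨hbB, hbA⟩ := Finset.mem_sdiff.1 hb
    have e1 : A \ B.erase b = A \ B := by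
      ext x
      by_cases h1 : x = b <;> simp_all
    have e2 : B.erase b \ A = (B \ A).erase b := Finset.erase_sdiff_comm B A b
    have hle : (B.erase b).card ≤ B.card := Finset.card_le_card (Finset.erase_subset b B)
    refine step (B.erase b) (M.hospPref_erase_of_not_acceptable hB hbB hbacc) (by omega)
      (e2 ▸ Finset.erase_subset _ _) ?_ ?_
    · rcases hsize with h1 | h1
      · exact Or.inl (by omega)
      · exact Or.inr fun x hx => h1 x (by rw [e2] at hx; exact Finset.mem_of_mem_erase hx)
    · rw [e1, e2, ← hn]
      have := Finset.card_erase_lt_of_mem hb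
      omega
  · push Not at hun
    have hs : B.card ≤ A.card := by
      rcases hsize with h1 | h1
      · exact h1
      · have : B ⊆ A := fun b hb => by
          by_contra hbA
          have hmem := Finset.mem_sdiff.2 ⟨hb, hbA⟩
          exact h1 b hmem (hun b hmem)
        exact Finset.card_le_card this
    have hsd : (B \ A).card ≤ (A \ B).card := by
      have h1 := Finset.card_sdiff_add_card_inter B A
      have h2 := Finset.card_sdiff_add_card_inter A B
      rw [Finset.inter_comm] at h2
      omega
    by_cases hAB : (A \ B).Nonempty
    · obtain ⟨a, ha⟩ := hAB
      obtain ⟨haA, haB⟩ := Finset.mem_sdiff.1 ha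
      by_cases hBA : (B \ A).Nonempty
      · obtain ⟨b, hb⟩ := hBA
        obtain ⟨hbB, hbA⟩ := Finset.mem_sdiff.1 hb
        obtain ⟨e1, e2⟩ := sdiff_swap_eq_erase ha hb
        have hcard : ((insert a B).erase b).card = B.card := by
          rw [Finset.card_erase_of_mem (Finset.mem_insert_of_mem hbB),
            Finset.card_insert_of_notMem haB]
          omega
        refine step ((insert a B).erase b)
          (M.hospPref_swap_of_ranks hB haB hbB (hrank b hb (hun b hb) a haA)) (by omega)
          (e2 ▸ Finset.erase_subset _ _) (Or.inl (by omega)) ?_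
        rw [e1, e2, ← hn]
        have h1 := Finset.card_erase_lt_of_mem hb
        have h2 := Finset.card_erase_lt_of_mem ha
        omega
      · have hBA' : B ⊆ A := by
          rwa [Finset.not_nonempty_iff_eq_empty, Finset.sdiff_eq_empty_iff_subset] at hBA
        have hlt : B.card < A.card :=
          Finset.card_lt_card ⟨hBA', fun hAB => haB (hAB haA)⟩
        have e1 : A \ insert a B = (A \ B).erase a := Finset.sdiff_insert A B a
        have e2 : insert a B \ A = B \ A := Finset.insert_sdiff_of_mem B haA
        have hcard := Finset.card_insert_of_notMem haB
        refine step (insert a B) (M.hospPref_insert_of_acceptable (by omega) haB (hacc a haA))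
          (by omega) e2.le (Or.inl (by omega)) ?_
        rw [e1, e2, ← hn]
        have := Finset.card_erase_lt_of_mem ha
        omega
    · have h1 : A ⊆ B := by
        rwa [Finset.not_nonempty_iff_eq_empty, Finset.sdiff_eq_empty_iff_subset] at hAB
      exact Or.inr (Finset.eq_of_subset_of_card_le h1 hs)

end Preferences

/-! ### Weak stability implies constrained efficiency -/

section Efficiency

variable {D H R : Type*} [Fintype H] (M : RegionalMarket D H R)

open Classical in
lemma sum_card_eq_card_regionDoctors (μ : RegionalMatching D H) (r : R) :
    ∑ h ∈ M.hospitals r, (μ.ofHospital h).card = (M.regionDoctors μ r).card := by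
  rw [regionDoctors, Finset.card_biUnion]
  intro h _ h' _ hne
  refine Finset.disjoint_left.2 fun d hd hd' => hne ?_
  rw [← μ.consistent] at hd hd'
  exact Option.some.inj (hd.symm.trans hd')

variable {M} in
/-- A feasible Pareto improvement `ν` of a weakly stable `μ` would give no hospital fewer doctors.
A doctor who moves makes her new hospital strictly larger, so that its region is not full in `μ`,
although some acceptable newcomer forms a blocking pair with that hospital in `μ`. -/
theorem WeaklyStable.constrainedEfficient {μ : RegionalMatching D H} (hμ : M.WeaklyStable μ) :
    M.ConstrainedEfficient μ := by
  classical
  obtain ⟨hfeas, hir, hblock⟩ := hμ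
  refine ⟨hfeas, ?_⟩
  rintro ⟨ν, hν, hdoc, hhosp, hstrict⟩
  have hnew : ∀ h, ∀ d ∈ ν.ofHospital h \ μ.ofHospital h, M.docPref d (some h) (μ.ofDoctor d) := by
    intro h d hd
    obtain ⟨h1, h2⟩ := Finset.mem_sdiff.1 hd
    rw [← ν.consistent] at h1
    rw [← μ.consistent] at h2
    rcases hdoc d with h3 | h3
    · rwa [h1] at h3
    · exact absurd (h3.symm.trans h1) h2
  have hrank : ∀ h, ∀ d ∈ ν.ofHospital h \ μ.ofHospital h, M.AcceptableDoctor h d →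
      ∀ a ∈ μ.ofHospital h, M.Ranks h a d := by
    intro h d hd hacc a ha
    rcases M.ranks_total h a d with h1 | rfl | h1
    · exact h1
    · exact absurd ha (Finset.mem_sdiff.1 hd).2
    · exact (hblock d h ⟨hnew h d hd, Or.inr ⟨a, ha, h1⟩⟩).2 a ha
  have hacc : ∀ h, ∀ a ∈ μ.ofHospital h, M.AcceptableDoctor h a := fun h a ha =>
    (hir a h ((μ.consistent a h).2 ha)).2
  have hkey : ∀ h, ν.ofHospital h = μ.ofHospital h ∨
      (μ.ofHospital h).card < (ν.ofHospital h).card ∧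
        ∃ d ∈ ν.ofHospital h \ μ.ofHospital h, M.AcceptableDoctor h d := by
    intro h
    by_contra hcon
    push Not at hcon
    obtain ⟨hne, hlt⟩ := hcon
    have hw : M.HospWeak h (μ.ofHospital h) (ν.ofHospital h) := by
      refine M.hospWeak_of_ranks_sdiff (hfeas.2 h) (hν.2 h) (hacc h) (hrank h) ?_
      rcases le_or_gt (ν.ofHospital h).card (μ.ofHospital h).card with h1 | h1
      · exact Or.inl h1
      · exact Or.inr (hlt h1)
    rcases hw with h1 | h1
    · rcases hhosp h with h2 | h2
      · exact M.hospPref_irrefl h _ (M.hospPref_trans h1 h2)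
      · exact hne h2
    · exact hne h1.symm
  by_cases hall : ∀ h, ν.ofHospital h = μ.ofHospital h
  · have hdoc_eq : ∀ d, ν.ofDoctor d = μ.ofDoctor d := fun d => by
      ext h
      rw [ν.consistent, μ.consistent, hall h]
    rcases hstrict with ⟨d, hd⟩ | ⟨h, hh⟩
    · exact M.docPref_irrefl d _ (hdoc_eq d ▸ hd)
    · exact M.hospPref_irrefl h _ (hall h ▸ hh)
  · push Not at hall
    obtain ⟨h, hh⟩ := hall
    obtain ⟨hlt, d, hd, hdacc⟩ := (hkey h).resolve_left hh
    have hfull := (hblock d h ⟨hnew h d hd, Or.inl ⟨lt_of_lt_of_le hlt (hν.2 h), hdacc⟩⟩).1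
    have hcap := hν.1 (M.region h)
    rw [← sum_card_eq_card_regionDoctors] at hcap
    have hsum : ∑ h' ∈ M.hospitals (M.region h), (μ.ofHospital h').card <
        ∑ h' ∈ M.hospitals (M.region h), (ν.ofHospital h').card := by
      refine Finset.sum_lt_sum (fun h' _ => ?_) ⟨h, by simp [hospitals], hlt⟩
      rcases hkey h' with h1 | h1
      · rw [h1]
      · exact h1.1.le
    omega

end Efficiency

/-! ### The choice of a hospital -/

section Keep

variable {D H R : Type*} (M : RegionalMarket D H R)

open Classical in
lemma mem_keep {h : H} {n : ℕ} {A : Finset D} {d : D} :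
    d ∈ M.keep h n A ↔
      d ∈ A ∧ M.AcceptableDoctor h d ∧ (A.filter fun d' => M.Ranks h d' d).card < n := by
  simp [keep]

/-- A doctor whom the hospital keeps from a pool is also kept from every smaller pool containing
her. -/
lemma mem_keep_of_subset {h : H} {n : ℕ} {A B : Finset D} (hAB : A ⊆ B) {d : D} (hdA : d ∈ A)
    (hd : d ∈ M.keep h n B) : d ∈ M.keep h n A := by
  classical
  rw [mem_keep] at hd ⊢
  exact ⟨hdA, hd.2.1, (Finset.card_le_card (Finset.filter_subset_filter _ hAB)).trans_lt hd.2.2⟩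

open Classical in
lemma card_ranks_injOn (h : H) (A : Finset D) :
    Set.InjOn (fun d => (A.filter fun d' => M.Ranks h d' d).card) A := by
  have key : ∀ a ∈ A, ∀ b, M.Ranks h a b →
      (A.filter fun d' => M.Ranks h d' a).card < (A.filter fun d' => M.Ranks h d' b).card := by
    intro a ha b hab
    refine Finset.card_lt_card ⟨fun x hx => ?_, fun hsub => ?_⟩
    · rw [Finset.mem_filter] at hx ⊢
      exact ⟨hx.1, M.ranks_trans hx.2 hab⟩
    · exact M.ranks_irrefl h a (Finset.mem_filter.1 (hsub (Finset.mem_filter.2 ⟨ha, hab⟩))).2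
  intro a ha b hb hab
  rcases M.ranks_total h a b with h1 | h1 | h1
  · exact absurd hab (key a ha b h1).ne
  · exact h1
  · exact absurd hab (key b hb a h1).ne'

lemma card_keep_le (h : H) (n : ℕ) (A : Finset D) : (M.keep h n A).card ≤ n := by
  classical
  have h1 := Finset.card_le_card_of_injOn (s := M.keep h n A) (t := Finset.range n)
    (fun d => (A.filter fun d' => M.Ranks h d' d).card)
    (fun d hd => by simpa using (M.mem_keep.1 hd).2.2)
    ((M.card_ranks_injOn h A).mono fun d hd => (M.mem_keep.1 hd).1)
  simpa using h1

/-- A hospital facing at least `n` acceptable doctors fills its `n` seats: the numbers of better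
acceptable doctors take every value below the number of acceptable doctors. -/
lemma le_card_keep {h : H} {n : ℕ} {A S : Finset D} (hSA : S ⊆ A)
    (hS : ∀ d ∈ S, M.AcceptableDoctor h d) (hn : n ≤ S.card) : n ≤ (M.keep h n A).card := by
  classical
  set T := A.filter fun d => M.AcceptableDoctor h d with hT
  have hST : S ⊆ T := fun d hd => Finset.mem_filter.2 ⟨hSA hd, hS d hd⟩
  have hnT : n ≤ T.card := hn.trans (Finset.card_le_card hST)
  set f : D → ℕ := fun d => (A.filter fun d' => M.Ranks h d' d).card with hf
  have himage : T.image f = Finset.range T.card := by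
    refine Finset.eq_of_subset_of_card_le ?_ ?_
    · intro i hi
      obtain ⟨d, hd, rfl⟩ := Finset.mem_image.1 hi
      obtain ⟨hdA, hdacc⟩ := Finset.mem_filter.1 hd
      refine Finset.mem_range.2 (Finset.card_lt_card ⟨fun x hx => ?_, fun hsub => ?_⟩)
      · obtain ⟨hx1, hx2⟩ := Finset.mem_filter.1 hx
        exact Finset.mem_filter.2 ⟨hx1, M.hospPref_trans hx2 hdacc⟩
      · exact M.ranks_irrefl h d (Finset.mem_filter.1 (hsub hd)).2
    · rw [Finset.card_range, Finset.card_image_of_injOn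
        ((M.card_ranks_injOn h A).mono fun d hd => (Finset.mem_filter.1 hd).1)]
  have hsub : Finset.range n ⊆ (M.keep h n A).image f := by
    intro i hi
    have hi' := Finset.mem_range.1 hi
    have : i ∈ T.image f := by rw [himage]; exact Finset.mem_range.2 (by omega)
    obtain ⟨d, hd, hdi⟩ := Finset.mem_image.1 this
    obtain ⟨hdA, hdacc⟩ := Finset.mem_filter.1 hd
    exact Finset.mem_image.2 ⟨d, M.mem_keep.2 ⟨hdA, hdacc, by rw [← hdi] at hi'; exact hi'⟩, hdi⟩
  calc n = (Finset.range n).card := (Finset.card_range n).symm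
    _ ≤ ((M.keep h n A).image f).card := Finset.card_le_card hsub
    _ ≤ (M.keep h n A).card := Finset.card_image_le

/-- A rejected acceptable doctor leaves behind a hospital without free seats. -/
lemma le_card_keep_of_notMem {h : H} {n : ℕ} {A : Finset D} {d : D} (hdA : d ∈ A)
    (hd : d ∉ M.keep h n A) (hacc : M.AcceptableDoctor h d) : n ≤ (M.keep h n A).card := by
  classical
  have hn : n ≤ (A.filter fun d' => M.Ranks h d' d).card := by
    by_contra hlt
    exact hd (M.mem_keep.2 ⟨hdA, hacc, not_le.1 hlt⟩)
  exact M.le_card_keep (Finset.filter_subset _ _)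
    (fun x hx => M.hospPref_trans (Finset.mem_filter.1 hx).2 hacc) hn

lemma ranks_of_mem_keep_of_notMem {h : H} {n : ℕ} {A : Finset D} {d d' : D} (hdA : d ∈ A)
    (hd : d ∉ M.keep h n A) (hd' : d' ∈ M.keep h n A) : M.Ranks h d' d := by
  classical
  obtain ⟨hd'A, hacc', hlt'⟩ := M.mem_keep.1 hd'
  by_cases hacc : M.AcceptableDoctor h d
  · rcases M.ranks_total h d' d with h1 | rfl | h1
    · exact h1
    · exact absurd hd' hd
    · refine absurd (M.mem_keep.2 ⟨hdA, hacc, lt_of_le_of_lt (Finset.card_le_card ?_) hlt'⟩) hd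
      intro x hx
      obtain ⟨hx1, hx2⟩ := Finset.mem_filter.1 hx
      exact Finset.mem_filter.2 ⟨hx1, M.ranks_trans hx2 h1⟩
  · exact M.ranks_of_acceptable_of_not hacc' hacc

end Keep

/-! ### Invariants and termination of deferred acceptance -/

section DeferredAcceptance

variable {D H R : Type*} (M : RegionalMarket D H R)

/-- The properties of a state that every step of the deferred acceptance algorithm with
capacities `t` preserves. -/
structure DAInvariant (t : H → ℕ) (s : DAState D H) : Prop where
  acceptableDoctor : ∀ h, ∀ d ∈ s.kept h, M.AcceptableDoctor h d
  acceptableHospital : ∀ h, ∀ d ∈ s.kept h, M.AcceptableHospital d h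
  not_rejected : ∀ h, ∀ d ∈ s.kept h, h ∉ s.rejectedBy d
  better_rejected : ∀ h, ∀ d ∈ s.kept h, ∀ h', M.docPref d (some h') (some h) → h' ∈ s.rejectedBy d
  card_le : ∀ h, (s.kept h).card ≤ t h
  ranks_rejected : ∀ h d, h ∈ s.rejectedBy d → ∀ d' ∈ s.kept h, M.Ranks h d' d
  le_card : ∀ h d, h ∈ s.rejectedBy d → M.AcceptableDoctor h d → t h ≤ (s.kept h).card

variable {M}

lemma DAInvariant.kept_unique {t : H → ℕ} {s : DAState D H} (hs : M.DAInvariant t s) {d : D}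
    {h h' : H} (hd : d ∈ s.kept h) (hd' : d ∈ s.kept h') : h = h' := by
  rcases M.docPref_total d (some h) (some h') with h1 | h1 | h1
  · exact absurd (hs.better_rejected h' d hd' h h1) (hs.not_rejected h d hd)
  · exact Option.some.inj h1
  · exact absurd (hs.better_rejected h d hd h' h1) (hs.not_rejected h' d hd')

/-- When no application occurs, every doctor is kept by the first acceptable hospital on her list
that has not rejected her. -/
lemma DAInvariant.mem_kept_iff {t : H → ℕ} {s : DAState D H} (hs : M.DAInvariant t s)
    (hfin : ∀ d h, ¬ M.AppliesTo s d h) {d : D} {h : H} :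
    d ∈ s.kept h ↔ M.AcceptableHospital d h ∧ h ∉ s.rejectedBy d ∧
      ∀ h', M.docPref d (some h') (some h) → h' ∈ s.rejectedBy d := by
  refine ⟨fun hd => ⟨hs.acceptableHospital h d hd, hs.not_rejected h d hd,
    hs.better_rejected h d hd⟩, ?_⟩
  rintro ⟨hacc, hrej, hbetter⟩
  by_cases hk : ∃ h', d ∈ s.kept h'
  · obtain ⟨h', hd'⟩ := hk
    rcases M.docPref_total d (some h) (some h') with h1 | h1 | h1
    · exact absurd (hs.better_rejected h' d hd' h h1) hrej
    · rwa [Option.some.inj h1]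
    · exact absurd (hbetter h' h1) (hs.not_rejected h' d hd')
  · push Not at hk
    refine absurd ⟨hk, hacc, hrej, fun h' hh' => ?_⟩ (hfin d h)
    rcases M.docPref_total d (some h) (some h') with h1 | h1 | h1
    · exact Or.inl h1
    · exact Or.inr h1
    · exact absurd (hbetter h' h1) hh'

/-- When no application occurs, a doctor whom no hospital keeps has been rejected by all acceptable
hospitals. -/
lemma rejected_of_unmatched [Finite H] {s : DAState D H}
    (hfin : ∀ d h, ¬ M.AppliesTo s d h) {d : D} (hd : ∀ h, d ∉ s.kept h) {h : H}
    (hacc : M.AcceptableHospital d h) : h ∈ s.rejectedBy d := by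
  by_contra hrej
  have hwf : WellFounded fun a b : H => M.docPref d (some a) (some b) := by
    have : IsTrans H fun a b => M.docPref d (some a) (some b) :=
      ⟨fun _ _ _ => M.docPref_trans⟩
    have : Std.Irrefl fun a b : H => M.docPref d (some a) (some b) :=
      ⟨fun _ => M.docPref_irrefl d _⟩
    exact Finite.wellFounded_of_trans_of_irrefl _
  obtain ⟨b, ⟨hbacc, hbrej⟩, hbest⟩ :=
    hwf.has_min {h | M.AcceptableHospital d h ∧ h ∉ s.rejectedBy d} ⟨h, hacc, hrej⟩
  refine hfin d b ⟨hd, hbacc, hbrej, fun h' hh' => ?_⟩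
  rcases M.docPref_total d (some b) (some h') with h1 | h1 | h1
  · exact Or.inl h1
  · exact Or.inr h1
  · exact absurd h1 (hbest h' ⟨M.docPref_trans h1 hbacc, hh'⟩)

variable [Fintype D]

lemma mem_pool {s : DAState D H} {h : H} {d : D} :
    d ∈ M.pool s h ↔ d ∈ s.kept h ∨ M.AppliesTo s d h := by
  simp [pool]

lemma kept_subset_pool (s : DAState D H) (h : H) : s.kept h ⊆ M.pool s h := fun _ hd =>
  mem_pool.2 (Or.inl hd)

lemma DAInvariant.of_mem_pool {t : H → ℕ} {s : DAState D H} (hs : M.DAInvariant t s) {d : D}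
    {h : H} (hd : d ∈ M.pool s h) : M.AcceptableHospital d h ∧ h ∉ s.rejectedBy d ∧
      ∀ h', M.docPref d (some h') (some h) → h' ∈ s.rejectedBy d := by
  rcases mem_pool.1 hd with hk | ⟨-, hacc, hrej, hbest⟩
  · exact ⟨hs.acceptableHospital h d hk, hs.not_rejected h d hk, hs.better_rejected h d hk⟩
  · refine ⟨hacc, hrej, fun h' hh' => ?_⟩
    by_contra hcon
    rcases hbest h' hcon with h1 | h1
    · exact M.docPref_irrefl d _ (M.docPref_trans h1 hh')
    · rw [h1] at hh'
      exact M.docPref_irrefl d _ hh'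

lemma DAInvariant.daStep {t : H → ℕ} {s : DAState D H} (hs : M.DAInvariant t s) :
    M.DAInvariant t (M.daStep t s) where
  acceptableDoctor h d hd := (M.mem_keep.1 hd).2.1
  acceptableHospital h d hd := (hs.of_mem_pool (M.mem_keep.1 hd).1).1
  not_rejected h d hd := by
    rintro (h1 | h1)
    · exact (hs.of_mem_pool (M.mem_keep.1 hd).1).2.1 h1
    · exact h1.2 hd
  better_rejected h d hd h' hh' := Or.inl ((hs.of_mem_pool (M.mem_keep.1 hd).1).2.2 h' hh')
  card_le h := M.card_keep_le h (t h) _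
  ranks_rejected h d hrej d' hd' := by
    classical
    rcases hrej with hrej | ⟨hpool, hnk⟩
    · obtain ⟨-, hacc', hlt'⟩ := M.mem_keep.1 hd'
      by_cases hacc : M.AcceptableDoctor h d
      · rcases M.ranks_total h d' d with h1 | h1 | h1
        · exact h1
        · subst h1
          exact absurd hrej (hs.of_mem_pool (M.mem_keep.1 hd').1).2.1
        -- The doctors already kept fill all seats and are better than `d`, hence than `d'`.
        · refine absurd ((hs.le_card h d hrej hacc).trans (Finset.card_le_card fun x hx => ?_))
            (not_le.2 hlt')
          exact Finset.mem_filter.2 ⟨kept_subset_pool s h hx,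
            M.ranks_trans (hs.ranks_rejected h d hrej x hx) h1⟩
      · exact M.ranks_of_acceptable_of_not hacc' hacc
    · exact M.ranks_of_mem_keep_of_notMem hpool hnk hd'
  le_card h d hrej hacc := by
    rcases hrej with hrej | ⟨hpool, hnk⟩
    · exact M.le_card_keep (kept_subset_pool s h) (hs.acceptableDoctor h)
        (hs.le_card h d hrej hacc)
    · exact M.le_card_keep_of_notMem hpool hnk hacc

variable (M)

lemma daState_succ (t : H → ℕ) (n : ℕ) :
    M.daState t (n + 1) = M.daStep t (M.daState t n) :=
  Function.iterate_succ_apply' _ _ _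

lemma daInvariant_daState (t : H → ℕ) (n : ℕ) : M.DAInvariant t (M.daState t n) := by
  induction n with
  | zero => constructor <;> simp [daState, daInit]
  | succ n ih => exact M.daState_succ t n ▸ ih.daStep

/-- The deferred acceptance algorithm with capacities `t` stops after exactly `n` steps. -/
def StopsAt (t : H → ℕ) (n : ℕ) : Prop :=
  (∀ d h, ¬ M.AppliesTo (M.daState t n) d h) ∧
    ∀ m < n, ∃ d h, M.AppliesTo (M.daState t m) d h

/-- The algorithm stops: the set of pairs `(d, h)` such that `d` has applied to `h` grows strictly
at every step with an application. -/
lemma exists_stopsAt [Finite H] (t : H → ℕ) : ∃ n, M.StopsAt t n := by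
  classical
  suffices hex : ∃ n, ∀ d h, ¬ M.AppliesTo (M.daState t n) d h by
    refine ⟨Nat.find hex, Nat.find_spec hex, fun m hm => ?_⟩
    have := Nat.find_min hex hm
    push Not at this
    exact this
  by_contra hcon
  push Not at hcon
  let offers : ℕ → Set (D × H) := fun n =>
    {p | p.2 ∈ (M.daState t n).rejectedBy p.1 ∨ p.1 ∈ (M.daState t n).kept p.2}
  have hpool : ∀ n d h, d ∈ M.pool (M.daState t n) h → (d, h) ∈ offers (n + 1) := by
    intro n d h hd
    change h ∈ (M.daState t (n + 1)).rejectedBy d ∨ d ∈ (M.daState t (n + 1)).kept h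
    rw [daState_succ]
    by_cases hk : d ∈ M.keep h (t h) (M.pool (M.daState t n) h)
    · exact Or.inr hk
    · exact Or.inl (Or.inr ⟨hd, hk⟩)
  have hlt : ∀ n, offers n ⊂ offers (n + 1) := by
    intro n
    refine ⟨?_, fun hsub => ?_⟩
    · rintro ⟨d, h⟩ (hp | hp)
      · left
        rw [daState_succ]
        exact Or.inl hp
      · exact hpool n d h (kept_subset_pool _ h hp)
    · obtain ⟨d, h, happ⟩ := hcon n
      rcases hsub (hpool n d h (mem_pool.2 (Or.inr happ))) with h1 | h1
      · exact happ.2.2.1 h1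
      · exact happ.1 h h1
  exact not_injective_infinite_finite offers (strictMono_nat_of_lt_succ hlt).injective

end DeferredAcceptance

/-! ### Comparison of the rejections under different capacities -/

section Comparison

variable {D H R : Type*} [Fintype D] (M : RegionalMarket D H R)

/-- Suppose that, once every doctor `d` has applied to all acceptable hospitals down to the first
one outside `X d`, each hospital rejects a doctor only if it lies in `X d`. Then `X` contains all
rejections of the deferred acceptance algorithm. -/
lemma rejectedBy_subset_of_closed (t : H → ℕ) (X : D → Set H) (A : H → Finset D)
    (hA : ∀ h d, d ∈ A h ↔ M.AcceptableHospital d h ∧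
      ∀ h', M.docPref d (some h') (some h) → h' ∈ X d)
    (hX : ∀ h, ∀ d ∈ A h, h ∉ X d → d ∈ M.keep h (t h) (A h)) (n : ℕ) (d : D) :
    (M.daState t n).rejectedBy d ⊆ X d := by
  induction n generalizing d with
  | zero => simp [daState, daInit]
  | succ n ih =>
    rw [daState_succ]
    rintro h (hrej | ⟨hpool, hnk⟩)
    · exact ih d hrej
    · have hsub : M.pool (M.daState t n) h ⊆ A h := fun x hx =>
        have hx' := (M.daInvariant_daState t n).of_mem_pool hx
        (hA h x).2 ⟨hx'.1, fun h' hh' => ih x (hx'.2.2 h' hh')⟩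
      by_contra hnX
      exact hnk (M.mem_keep_of_subset hsub hpool (hX h d (hsub hpool) hnX))

/-- If the algorithm with capacities `t` stops at `s`, then capacities `t'` that accommodate
everybody kept in `s` lead to no further rejections. -/
lemma rejectedBy_subset_of_card_kept_le {t : H → ℕ} {s : DAState D H} (hs : M.DAInvariant t s)
    (hfin : ∀ d h, ¬ M.AppliesTo s d h) {t' : H → ℕ} (ht' : ∀ h, (s.kept h).card ≤ t' h) (n : ℕ)
    (d : D) : (M.daState t' n).rejectedBy d ⊆ s.rejectedBy d := by
  classical
  refine M.rejectedBy_subset_of_closed t' s.rejectedBy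
    (fun h => Finset.univ.filter fun d => M.AcceptableHospital d h ∧
      ∀ h', M.docPref d (some h') (some h) → h' ∈ s.rejectedBy d) (fun h d => by simp) ?_ n d
  intro h d hd hrej
  have hd' := (Finset.mem_filter.1 hd).2
  have hk : d ∈ s.kept h := (hs.mem_kept_iff hfin).2 ⟨hd'.1, hrej, hd'.2⟩
  refine M.mem_keep.2 ⟨hd, hs.acceptableDoctor h d hk, lt_of_lt_of_le ?_ (ht' h)⟩
  -- Everybody ranked above `d` is kept: the doctors rejected by `h` are ranked below `d`.
  refine Finset.card_lt_card ⟨fun x hx => ?_, fun hsub => ?_⟩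
  · obtain ⟨hx1, hx2⟩ := Finset.mem_filter.1 hx
    have hx' := (Finset.mem_filter.1 hx1).2
    refine (hs.mem_kept_iff hfin).2 ⟨hx'.1, fun hxrej => ?_, hx'.2⟩
    exact M.ranks_irrefl h d (M.ranks_trans (hs.ranks_rejected h x hxrej d hk) hx2)
  · exact M.ranks_irrefl h d (Finset.mem_filter.1 (hsub hk)).2

end Comparison

/-! ### The matching produced, and the choice of the allocation -/

section Allocation

variable {D H R : Type*} (M : RegionalMarket D H R)

variable {M} in
/-- The matching given by a state in which every doctor is kept by at most one hospital. -/
lemma DAInvariant.exists_matching {t : H → ℕ} {s : DAState D H} (hs : M.DAInvariant t s) :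
    ∃ μ : RegionalMatching D H, ∀ h, μ.ofHospital h = s.kept h := by
  classical
  refine ⟨⟨fun d => if hd : ∃ h, d ∈ s.kept h then some hd.choose else none, s.kept, ?_⟩,
    fun _ => rfl⟩
  intro d h
  by_cases hd : ∃ h, d ∈ s.kept h
  · rw [dif_pos hd, Option.some_inj]
    exact ⟨fun e => e ▸ hd.choose_spec, fun hk => hs.kept_unique hd.choose_spec hk⟩
  · rw [dif_neg hd]
    exact ⟨fun e => by simp at e, fun hk => absurd ⟨h, hk⟩ hd⟩

variable {M} in
lemma DAInvariant.rejected_of_docPref [Finite H] {t : H → ℕ} {s : DAState D H}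
    (hs : M.DAInvariant t s) (hfin : ∀ d h, ¬ M.AppliesTo s d h) {μ : RegionalMatching D H}
    (hμ : ∀ h, μ.ofHospital h = s.kept h) {d : D} {h : H}
    (hd : M.docPref d (some h) (μ.ofDoctor d)) : h ∈ s.rejectedBy d := by
  cases e : μ.ofDoctor d with
  | none =>
    refine rejected_of_unmatched hfin (fun h' hk => ?_) (by rwa [e] at hd)
    rw [← hμ, ← μ.consistent, e] at hk
    simp at hk
  | some h' =>
    have hk : d ∈ s.kept h' := by rw [← hμ, ← μ.consistent, e]
    exact hs.better_rejected h' d hk h (by rwa [e] at hd)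

variable [Fintype D] [Fintype H]

/-- If the rejections leading to `s` are minimal and `h` has rejected an acceptable doctor without
exhausting its physical capacity, then the region of `h` is full. Otherwise `h` could get one seat
more than it fills, and every other hospital the seats it fills; this creates no rejection and, by
minimality, removes none, so that the new seat would stay empty. -/
lemma sum_card_eq_cap_of_minimal {t : H → ℕ} {s : DAState D H} (ht : M.IsAllocation t)
    (hs : M.DAInvariant t s) (hfin : ∀ d h, ¬ M.AppliesTo s d h)
    (hmin : ∀ t', M.IsAllocation t' → ∀ n, M.StopsAt t' n →
      (∀ d, (M.daState t' n).rejectedBy d ⊆ s.rejectedBy d) →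
      (M.daState t' n).rejectedBy = s.rejectedBy)
    {d : D} {h : H} (hacc : M.AcceptableDoctor h d) (hrej : h ∈ s.rejectedBy d)
    (hlt : (s.kept h).card < M.capacity h) :
    ∑ h' ∈ M.hospitals (M.region h), (s.kept h').card = M.cap (M.region h) := by
  classical
  have hsum : ∀ r, ∑ h' ∈ M.hospitals r, (s.kept h').card ≤ M.cap r := fun r =>
    (Finset.sum_le_sum fun h' _ => hs.card_le h').trans (ht.1 r)
  by_contra hne
  let t' : H → ℕ := fun h' => (s.kept h').card + if h' = h then 1 else 0
  have ht' : M.IsAllocation t' := by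
    constructor
    · intro r
      rw [Finset.sum_add_distrib, Finset.sum_ite_eq']
      split_ifs with hr
      · have hr' : M.region h = r := by simpa [hospitals] using hr
        have := hsum r
        subst hr'
        omega
      · simpa using hsum r
    · intro h'
      simp only [t']
      split_ifs with e
      · subst e
        omega
      · exact (hs.card_le h').trans (ht.2 h')
  obtain ⟨n, hn⟩ := M.exists_stopsAt t'
  have hinv := M.daInvariant_daState t' n
  have heq := hmin t' ht' n hn
    (M.rejectedBy_subset_of_card_kept_le hs hfin (fun h' => Nat.le_add_right _ _) n)
  -- The rejections determine who is kept, so the additional seat at `h` remains empty, although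
  -- `h` rejects the acceptable doctor `d`.
  have hkept : (M.daState t' n).kept h = s.kept h := by
    ext x
    rw [hinv.mem_kept_iff hn.1, hs.mem_kept_iff hfin, heq]
  have hfull := hinv.le_card h d (heq ▸ hrej) hacc
  rw [hkept] at hfull
  simp [t'] at hfull

/-- Some allocation has a minimal set of rejections. -/
lemma exists_minimal_allocation : ∃ t, M.IsAllocation t ∧ ∃ n, M.StopsAt t n ∧
    ∀ t', M.IsAllocation t' → ∀ m, M.StopsAt t' m →
      (∀ d, (M.daState t' m).rejectedBy d ⊆ (M.daState t n).rejectedBy d) →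
      (M.daState t' m).rejectedBy = (M.daState t n).rejectedBy := by
  let S : Set (D → Set H) :=
    {X | ∃ t, M.IsAllocation t ∧ ∃ n, M.StopsAt t n ∧ (M.daState t n).rejectedBy = X}
  have hS : S.Nonempty := by
    obtain ⟨n, hn⟩ := M.exists_stopsAt (fun _ => 0)
    exact ⟨_, fun _ => 0, ⟨fun r => by simp, fun h => Nat.zero_le _⟩, n, hn, rfl⟩
  obtain ⟨X, ⟨t, ht, n, hn, rfl⟩, hmin⟩ := (Set.toFinite S).exists_minimal hS
  exact ⟨t, ht, n, hn, fun t' ht' m hm hsub =>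
    le_antisymm hsub (hmin ⟨t', ht', m, hm, rfl⟩ hsub)⟩

end Allocation

end RegionalMarket

theorem corollary1 {D H R : Type*} [Fintype D] [Fintype H] [Fintype R]
    (M : RegionalMarket D H R) :
    ∃ t : H → ℕ, M.IsAllocation t ∧
      ∃ μ : RegionalMatching D H,
        M.DAProduces t μ ∧ M.ConstrainedEfficient μ ∧ M.WeaklyStable μ := by
  obtain ⟨t, ht, n, hfinal, hmin⟩ := M.exists_minimal_allocation
  have hs := M.daInvariant_daState t n
  obtain ⟨μ, hμ⟩ := hs.exists_matching
  have hcard : ∀ h, (μ.ofHospital h).card ≤ t h := fun h => hμ h ▸ hs.card_le h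
  have hstable : M.WeaklyStable μ := by
    refine ⟨⟨fun r => ?_, fun h => (hcard h).trans (ht.2 h)⟩, fun d h hd => ?_, ?_⟩
    · rw [← M.sum_card_eq_card_regionDoctors]
      exact (Finset.sum_le_sum fun h _ => hcard h).trans (ht.1 r)
    · rw [μ.consistent, hμ] at hd
      exact ⟨hs.acceptableHospital h d hd, hs.acceptableDoctor h d hd⟩
    · rintro d h ⟨hpref, hblock⟩
      have hrej := hs.rejected_of_docPref hfinal.1 hμ hpref
      have hrank := hs.ranks_rejected h d hrej
      have hfree : (μ.ofHospital h).card < M.capacity h ∧ M.AcceptableDoctor h d := by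
        refine hblock.resolve_right ?_
        rintro ⟨d', hd', hdd'⟩
        exact M.ranks_irrefl h d (M.ranks_trans hdd' (hrank d' (hμ h ▸ hd')))
      simp only [hμ] at hfree ⊢
      exact ⟨M.sum_card_eq_cap_of_minimal ht hs hfinal.1 hmin hfree.2 hrej hfree.1, hrank⟩
  exact ⟨t, ht, μ, ⟨n, hfinal.1, hfinal.2, hμ⟩, hstable.constrainedEfficient, hstable⟩
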